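/- Let $A$ be an Artin algebra, i.e. an algebra over a commutative Artinian ring $R$ that is finitely generated as an $R$-module. All modules are finitely generated, and modules are left modules unless stated otherwise. For a ring $\Lambda$ and a $\Lambda$-module $M$, let $M^*=\operatorname{Hom}_\Lambda(M,\Lambda)$ be its dual, a right $\Lambda$-module. A (left or right) $\Lambda$-module $M$ is *semi-Gorenstein-projective* if $\operatorname{Ext}^i_\Lambda(M,\Lambda)=0$ for all $i\ge 1$; a left module $M$ is *double semi-Gorenstein-projective* if both $M$ and $M^*$ are semi-Gorenstein-projective; and $M$ is *torsionless* if it is isomorphic to a submodule of a projective module. Let $\operatorname{add}(A)$ be the class of direct summands of finite direct sums of copies of ${}_AA$. A *left $\operatorname{add}(A)$-approximation* of an $A$-module $Y$ is an $A$-homomorphism $\varphi:Y\to P$ with $P\in\operatorname{add}(A)$ such that every $A$-homomorphism from $Y$ to a module in $\operatorname{add}(A)$ factors through $\varphi$. Let $T_2(A)=\begin{pmatrix}A&A\\0&A\end{pmatrix}$. For an $A$-homomorphism $\varphi:Y\to X$, let $\binom{X}{Y}_\varphi$ be the left $T_2(A)$-module $X\oplus Y$ with $\begin{pmatrix}a&b\\0&d\end{pmatrix}\binom{x}{y}=\binom{ax+b\varphi(y)}{dy}$.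 It is called *monic* if $\varphi$ is injective. **Theorem.** Let $Y$ be a double semi-Gorenstein-projective $A$-module which is not torsionless, and let $\varphi:Y\to P$ be a left $\operatorname{add}(A)$-approximation of $Y$. Then $\binom{P}{Y}_\varphi$ is a double semi-Gorenstein-projective $T_2(A)$-module which is not monic. In particular, $\binom{P}{Y}_\varphi$ is not torsionless. -/

import Mathlib

open CategoryTheory

universe u

section Homological

variable (A : Type u) [Ring A] (M : Type u) [AddCommGroup M] [Module A M]

/-- A left `A`-module `M` is semi-Gorenstein-projective if it is finitely generated and
`Ext_A^i(M, A) = 0` for all `i ≥ 1`. -/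
def IsSemiGorensteinProjective : Prop :=
  Module.Finite A M ∧
    ∀ i : ℕ, 1 ≤ i → Subsingleton (Abelian.Ext (ModuleCat.of A M) (ModuleCat.of A A) i)

/-- `M` is double semi-Gorenstein-projective if both `M` and its `A`-dual `M^* = Hom_A(M, A)` are
semi-Gorenstein-projective. The dual is a right `A`-module by `(f a)(m) = f(m) a`, that is, a left
module over the opposite ring. -/
def IsDoubleSemiGorensteinProjective : Prop :=
  IsSemiGorensteinProjective A M ∧ IsSemiGorensteinProjective Aᵐᵒᵖ (Module.Dual A M)

/-- `M` is torsionless if it is isomorphic to a submodule of a (finitely generated) projective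
module. -/
def IsTorsionlessModule : Prop :=
  ∃ (Q : Type u) (_ : AddCommGroup Q) (_ : Module A Q) (f : M →ₗ[A] Q),
    Module.Finite A Q ∧ Module.Projective A Q ∧ Function.Injective f

/-- `M` belongs to `add(A)`: it is a direct summand of a finite direct sum of copies of the
regular module `A`. -/
def IsInAdd : Prop :=
  ∃ (n : ℕ) (s : M →ₗ[A] (Fin n → A)) (r : (Fin n → A) →ₗ[A] M), r ∘ₗ s = LinearMap.id

end Homological

/-- `φ : Y → P` is a left `add(A)`-approximation of `Y`: `P` is in `add(A)` and each map from `Y`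
to a module in `add(A)` factors through `φ`. -/
def IsLeftAddApproximation {A : Type u} [Ring A] {Y P : Type u} [AddCommGroup Y] [Module A Y]
    [AddCommGroup P] [Module A P] (φ : Y →ₗ[A] P) : Prop :=
  IsInAdd A P ∧
    ∀ (Q : Type u) [AddCommGroup Q] [Module A Q], IsInAdd A Q →
      ∀ f : Y →ₗ[A] Q, ∃ g : P →ₗ[A] Q, g ∘ₗ φ = f

/-- The ring `T_2(A)` of upper triangular `2 × 2` matrices over `A`. -/
def T2 (A : Type u) [Ring A] : Subring (Matrix (Fin 2) (Fin 2) A) where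
  carrier := {m | m 1 0 = 0}
  mul_mem' := by
    intro a b ha hb
    simp only [Set.mem_ofPred_eq] at *
    simp [Matrix.mul_apply, Fin.sum_univ_two, ha, hb]
  one_mem' := by simp
  add_mem' := by
    intro a b ha hb
    simp only [Set.mem_ofPred_eq] at *
    simp [ha, hb]
  zero_mem' := by simp
  neg_mem' := by
    intro a ha
    simp only [Set.mem_ofPred_eq] at *
    simp [ha]

namespace T2

variable {A : Type u} [Ring A]

/-- The matrix unit `e_{12}`. -/
def e12 : T2 A := ⟨!![0, 1; 0, 0], show (0 : A) = 0 from rfl⟩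

/-- The matrix unit `e_{22}`. -/
def e22 : T2 A := ⟨!![0, 0; 0, 1], show (0 : A) = 0 from rfl⟩

/-- A left `T_2(A)`-module `M` is monic if its structure map `e_{22} M → e_{11} M`,
`m ↦ e_{12} m`, is injective. Under the identification of `T_2(A)`-modules with triples
`(X, Y)_φ` this is the map `φ : Y → X`, see `T2.isMonic_triple`. -/
def IsMonic (M : Type u) [AddCommGroup M] [Module (T2 A) M] : Prop :=
  Set.InjOn (fun m : M => (e12 : T2 A) • m) (Set.range fun m : M => (e22 : T2 A) • m)

variable {X Y : Type u} [AddCommGroup X] [Module A X] [AddCommGroup Y] [Module A Y]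

/-- The underlying group `X × Y` of the `T_2(A)`-module `(X, Y)_φ` given by an `A`-linear map
`φ : Y → X`. -/
def Triple (_φ : Y →ₗ[A] X) : Type u := X × Y

instance (φ : Y →ₗ[A] X) : AddCommGroup (Triple φ) := inferInstanceAs (AddCommGroup (X × Y))

/-- The `T_2(A)`-module structure of `(X, Y)_φ`: the matrix with rows `(a, b)` and `(0, d)` sends
the column `(x, y)` to `(a x + b φ(y), d y)`. -/
instance (φ : Y →ₗ[A] X) : Module (T2 A) (Triple φ) where
  smul t v := (t.1 0 0 • v.1 + t.1 0 1 • φ v.2, t.1 1 1 • v.2)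
  one_smul v := by
    refine Prod.ext ?_ ?_
    · change (1 : Matrix (Fin 2) (Fin 2) A) 0 0 • v.1
        + (1 : Matrix (Fin 2) (Fin 2) A) 0 1 • φ v.2 = v.1
      simp
    · change (1 : Matrix (Fin 2) (Fin 2) A) 1 1 • v.2 = v.2
      simp
  mul_smul s t v := by
    have hs : s.1 1 0 = 0 := s.2
    have ht : t.1 1 0 = 0 := t.2
    refine Prod.ext ?_ ?_
    · change (s.1 * t.1) 0 0 • v.1 + (s.1 * t.1) 0 1 • φ v.2
        = s.1 0 0 • (t.1 0 0 • v.1 + t.1 0 1 • φ v.2) + s.1 0 1 • φ (t.1 1 1 • v.2)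
      simp [Matrix.mul_apply, Fin.sum_univ_two, ht, add_smul, mul_smul, add_assoc]
    · change (s.1 * t.1) 1 1 • v.2 = s.1 1 1 • t.1 1 1 • v.2
      simp [Matrix.mul_apply, Fin.sum_univ_two, hs, mul_smul]
  smul_zero t := by
    refine Prod.ext ?_ ?_
    · change t.1 0 0 • (0 : X) + t.1 0 1 • φ (0 : Y) = 0
      simp
    · change t.1 1 1 • (0 : Y) = 0
      simp
  smul_add t v w := by
    refine Prod.ext ?_ ?_
    · change t.1 0 0 • (v.1 + w.1) + t.1 0 1 • φ (v.2 + w.2)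
        = (t.1 0 0 • v.1 + t.1 0 1 • φ v.2) + (t.1 0 0 • w.1 + t.1 0 1 • φ w.2)
      simp only [smul_add, map_add]
      abel
    · change t.1 1 1 • (v.2 + w.2) = t.1 1 1 • v.2 + t.1 1 1 • w.2
      rw [smul_add]
  add_smul s t v := by
    refine Prod.ext ?_ ?_
    · change (s.1 + t.1) 0 0 • v.1 + (s.1 + t.1) 0 1 • φ v.2
        = (s.1 0 0 • v.1 + s.1 0 1 • φ v.2) + (t.1 0 0 • v.1 + t.1 0 1 • φ v.2)
      simp only [Matrix.add_apply, add_smul]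
      abel
    · change (s.1 + t.1) 1 1 • v.2 = s.1 1 1 • v.2 + t.1 1 1 • v.2
      rw [Matrix.add_apply, add_smul]
  zero_smul v := by
    refine Prod.ext ?_ ?_
    · change (0 : Matrix (Fin 2) (Fin 2) A) 0 0 • v.1
        + (0 : Matrix (Fin 2) (Fin 2) A) 0 1 • φ v.2 = 0
      simp
    · change (0 : Matrix (Fin 2) (Fin 2) A) 1 1 • v.2 = 0
      simp

/-- The element of `(X, Y)_φ` with components `x` and `y`. -/
def Triple.mk (φ : Y →ₗ[A] X) (x : X) (y : Y) : Triple φ := (x, y)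

theorem smul_mk (φ : Y →ₗ[A] X) (t : T2 A) (x : X) (y : Y) :
    t • Triple.mk φ x y = Triple.mk φ (t.1 0 0 • x + t.1 0 1 • φ y) (t.1 1 1 • y) := rfl

/-- The module `(X, Y)_φ` is monic if and only if `φ` is a monomorphism. -/
theorem isMonic_triple (φ : Y →ₗ[A] X) :
    IsMonic (A := A) (Triple φ) ↔ Function.Injective φ := by
  have h22 : ∀ (x : X) (y : Y), (e22 : T2 A) • Triple.mk φ x y = Triple.mk φ 0 y := by
    intro x y
    rw [smul_mk]
    simp [e22]
  have h12 : ∀ (x : X) (y : Y), (e12 : T2 A) • Triple.mk φ x y = Triple.mk φ (φ y) 0 := by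
    intro x y
    rw [smul_mk]
    simp [e12]
  constructor
  · intro h y y' hy
    have key : Triple.mk φ 0 y = Triple.mk φ 0 y' := by
      refine h ⟨Triple.mk φ 0 y, h22 0 y⟩ ⟨Triple.mk φ 0 y', h22 0 y'⟩ ?_
      change (e12 : T2 A) • Triple.mk φ 0 y = (e12 : T2 A) • Triple.mk φ 0 y'
      rw [h12, h12, hy]
    exact congrArg Prod.snd key
  · rintro h _ ⟨v, rfl⟩ _ ⟨w, rfl⟩ hvw
    obtain ⟨x, y, rfl⟩ : ∃ x y, v = Triple.mk φ x y := ⟨v.1, v.2, rfl⟩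
    obtain ⟨x', y', rfl⟩ : ∃ x y, w = Triple.mk φ x y := ⟨w.1, w.2, rfl⟩
    change (e12 : T2 A) • (e22 : T2 A) • Triple.mk φ x y
      = (e12 : T2 A) • (e22 : T2 A) • Triple.mk φ x' y' at hvw
    change (e22 : T2 A) • Triple.mk φ x y = (e22 : T2 A) • Triple.mk φ x' y'
    rw [h22, h22, h12, h12] at hvw
    rw [h22, h22, h (congrArg Prod.fst hvw)]

end T2

/-
Restriction of scalars along the diagonal `A → T_2(A)` sends `(X, Y)_φ` to `X × Y` and has an exact
right adjoint, so Ext from `(X, Y)_φ` into the modules `(N, N)` and `(0, N)`, which are summands of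
values of that adjoint, vanishes whenever Ext from `X × Y` into `N` does. For `(N, 0)` one uses
`0 → (N, 0) → (N, N) → (0, N) → 0`; the only obstruction left is in degree one, and it disappears
when every map `Y → N` factors through `φ`. As `T_2(A) ≅ (A, 0) ⊕ (A, A)` as a left module,
`(P, Y)_φ` is semi-Gorenstein-projective.

The dual of `(P, Y)_φ` is the triple `Ker φ^* → P^*` over `T_2(A)^op ≅ T_2(A^op)`. The approximation
property says that `φ^*` is surjective, so `Ker φ^*` is a syzygy of `Y^*`, and the maps
`Ker φ^* → A` extend to `P^*` because `Ext^1(Y^*, A) = 0`: the same criterion applies.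

Submodules of projective `T_2(A)`-modules are monic, and `φ` is not injective since `Y` is not
torsionless.
-/

section

open Abelian Limits

variable {C D : Type*} [Category C] [Abelian C] [HasExt C] [Category D] [Abelian D] [HasExt D]

theorem subsingleton_ext_of_retract {X X' Y Y' : C} (h : Retract X X') (k : Retract Y Y') {n : ℕ}
    (hn : Subsingleton (Ext X' Y' n)) : Subsingleton (Ext X Y n) := by
  refine subsingleton_of_forall_eq 0 fun x => ?_
  calc
    x = (Ext.mk₀ h.i).comp (((Ext.mk₀ h.r).comp (x.comp (Ext.mk₀ k.i) (add_zero n))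
      (zero_add n)).comp (Ext.mk₀ k.r) (add_zero n)) (zero_add n) := by simp
    _ = 0 := by rw [Subsingleton.elim ((Ext.mk₀ h.r).comp _ _) 0, Ext.zero_comp, Ext.comp_zero]

variable {F : C ⥤ D} {G : D ⥤ C} [F.Additive] [PreservesFiniteLimits F] [PreservesFiniteColimits F]

/-- For an exact left adjoint `F` of `G`, the natural map `Ext(X, G Y) → Ext(F X, Y)`: apply `F`,
then compose with the counit. -/
noncomputable def extAdjunctionHom (adj : F ⊣ G) (X : C) (Y : D) (n : ℕ) :
    Ext X (G.obj Y) n →+ Ext (F.obj X) Y n :=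
  ((Ext.mk₀ (adj.counit.app Y)).postcomp (F.obj X) (add_zero n)).comp (F.mapExtAddHom X (G.obj Y) n)

theorem extAdjunctionHom_mk₀ (adj : F ⊣ G) {X : C} {Y : D} (f : X ⟶ G.obj Y) :
    extAdjunctionHom adj X Y 0 (Ext.mk₀ f) = Ext.mk₀ ((adj.homEquiv X Y).symm f) := by
  simp [extAdjunctionHom, Ext.mapExactFunctor_mk₀, Adjunction.homEquiv_counit]

theorem extAdjunctionHom_precomp (adj : F ⊣ G) {X X' : C} {Y : D} {m n k : ℕ}
    {x : Ext X X' m} {x' : Ext (F.obj X) (F.obj X') m} (hx : x.mapExactFunctor F = x')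
    (h : m + n = k) :
    (extAdjunctionHom adj X Y k).comp (x.precomp (G.obj Y) h) =
      (x'.precomp Y h).comp (extAdjunctionHom adj X' Y n) := by
  ext
  simp [extAdjunctionHom, Ext.mapExactFunctor_comp, hx]

theorem extAdjunctionHom_bijective_zero (adj : F ⊣ G) (X : C) (Y : D) :
    Function.Bijective (extAdjunctionHom adj X Y 0) := by
  refine (Function.Bijective.of_comp_iff _ (Ext.mk₀_bijective X (G.obj Y))).1 ?_
  convert (Ext.mk₀_bijective (F.obj X) Y).comp (adj.homEquiv X Y).symm.bijective using 1
  exact funext (extAdjunctionHom_mk₀ adj)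

attribute [local instance] Ext.subsingleton_of_projective in
theorem extAdjunctionHom_bijective [EnoughProjectives C] [F.PreservesProjectiveObjects]
    (adj : F ⊣ G) (X : C) (Y : D) (n : ℕ) :
    Function.Bijective (extAdjunctionHom adj X Y n) := by
  induction n generalizing X with
  | zero => exact extAdjunctionHom_bijective_zero adj X Y
  | succ n ih =>
    let P : ProjectivePresentation X := Classical.arbitrary _
    let S := ShortComplex.mk _ _ (kernel.condition P.f)
    have : Projective (S.map F).X₂ := Functor.PreservesProjectiveObjects.projective_obj P.projective
    have hS : S.ShortExact := { exact := ShortComplex.exact_kernel P.f }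
    exact AddMonoidHom.bijective_of_surjective_of_bijective_of_right_exact _ _ _ _
      (extAdjunctionHom adj S.X₂ Y n) (extAdjunctionHom adj S.X₁ Y n)
      (extAdjunctionHom adj S.X₃ Y (n + 1))
      (extAdjunctionHom_precomp adj (Ext.mapExactFunctor_mk₀ F S.f) (zero_add n)).symm
      (extAdjunctionHom_precomp adj (Ext.mapExactFunctor_extClass F hS) (add_comm 1 n)).symm
      ((ShortComplex.ab_exact_iff_function_exact _).1
        (Ext.contravariant_sequence_exact₁' hS _ n (n + 1) (add_comm 1 n)))
      ((ShortComplex.ab_exact_iff_function_exact _).1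
        (Ext.contravariant_sequence_exact₁' (hS.map F) Y n (n + 1) (add_comm 1 n)))
      (ih _).surjective (ih _)
      (fun x₃ => Ext.contravariant_sequence_exact₃ hS _ x₃ (by subsingleton) (add_comm 1 n))
      (fun y₃ => Ext.contravariant_sequence_exact₃ (hS.map F) _ y₃ (by subsingleton) (add_comm 1 n))

theorem subsingleton_ext_X₁ {X : C} {S : ShortComplex C} (hS : S.ShortExact) {n : ℕ}
    (h₂ : Subsingleton (Ext X S.X₂ (n + 1)))
    (hn : Function.Surjective ((Ext.mk₀ S.g).postcomp X (add_zero n))) :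
    Subsingleton (Ext X S.X₁ (n + 1)) := by
  refine subsingleton_of_forall_eq 0 fun x => ?_
  obtain ⟨y, rfl⟩ := Ext.covariant_sequence_exact₁ X hS x (Subsingleton.elim _ _) rfl
  obtain ⟨z, rfl⟩ := hn y
  simp

end

section

variable {R S : Type u} [Ring R] [Ring S] (f : R →+* S)

theorem restrictScalars_map_exact (T : ShortComplex (ModuleCat.{u} S)) (hT : T.Exact) :
    (T.map (ModuleCat.restrictScalars.{u} f)).Exact := by
  rw [ShortComplex.ShortExact.moduleCat_exact_iff_function_exact] at hT ⊢
  exact hT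

instance : Limits.PreservesFiniteLimits (ModuleCat.restrictScalars.{u} f) :=
  (((Functor.exact_tfae (ModuleCat.restrictScalars.{u} f)).out 1 3 rfl rfl).1
    (restrictScalars_map_exact f)).1

instance : Limits.PreservesFiniteColimits (ModuleCat.restrictScalars.{u} f) :=
  (((Functor.exact_tfae (ModuleCat.restrictScalars.{u} f)).out 1 3 rfl rfl).1
    (restrictScalars_map_exact f)).2

theorem finite_of_finite_restrictScalars {V : Type u} [AddCommGroup V] [Module S V]
    (h : Module.Finite R ((ModuleCat.restrictScalars f).obj (ModuleCat.of S V))) :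
    Module.Finite S V :=
  let := Module.compHom V f
  let := Module.compHom S f
  have : IsScalarTower R S V := ⟨fun r s v => mul_smul (f r) s v⟩
  have : Module.Finite R V := h
  .of_restrictScalars_finite R S V

end

section

variable {R : Type u} [Ring R] {M N Q : Type u} [AddCommGroup M] [Module R M] [AddCommGroup N]
  [Module R N] [AddCommGroup Q] [Module R Q]

theorem exists_extension_of_subsingleton_ext_one {f : Q →ₗ[R] M} (hf : Function.Surjective f)
    (h : Subsingleton (Abelian.Ext (ModuleCat.of R M) (ModuleCat.of R N) 1))
    (k : LinearMap.ker f →ₗ[R] N) : ∃ l : Q →ₗ[R] N, l ∘ₗ (LinearMap.ker f).subtype = k := by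
  obtain ⟨x, hx⟩ := Abelian.Ext.contravariant_sequence_exact₁
    (LinearMap.shortExact_shortComplexKer hf) (ModuleCat.of R N)
    (Abelian.Ext.mk₀ (ModuleCat.ofHom k)) (add_zero 1) (h.elim _ _)
  obtain ⟨l, rfl⟩ := (Abelian.Ext.mk₀_bijective _ _).2 x
  rw [Abelian.Ext.mk₀_comp_mk₀] at hx
  exact ⟨l.hom, congrArg ModuleCat.Hom.hom ((Abelian.Ext.mk₀_bijective _ _).1 hx)⟩

theorem subsingleton_ext_of_projective (hQ : Module.Projective R Q) {i : ℕ} (hi : 1 ≤ i) :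
    Subsingleton (Abelian.Ext (ModuleCat.of R Q) (ModuleCat.of R N) i) := by
  obtain ⟨i, rfl⟩ := Nat.exists_eq_add_of_le' hi
  have : Projective (ModuleCat.of R Q) := (IsProjective.iff_projective Q).1 hQ
  exact Abelian.Ext.subsingleton_of_projective _ _ _

theorem subsingleton_ext_ker {f : Q →ₗ[R] M} (hf : Function.Surjective f)
    (hQ : Module.Projective R Q) {i : ℕ} (hi : 1 ≤ i)
    (h : Subsingleton (Abelian.Ext (ModuleCat.of R M) (ModuleCat.of R N) (i + 1))) :
    Subsingleton (Abelian.Ext (ModuleCat.of R (LinearMap.ker f)) (ModuleCat.of R N) i) := by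
  have := subsingleton_ext_of_projective (N := N) hQ hi
  refine subsingleton_of_forall_eq 0 fun x => ?_
  obtain ⟨y, rfl⟩ := Abelian.Ext.contravariant_sequence_exact₁
    (LinearMap.shortExact_shortComplexKer hf) (ModuleCat.of R N) x (add_comm 1 i) (h.elim _ _)
  rw [Subsingleton.elim (α := Abelian.Ext (ModuleCat.of R Q) (ModuleCat.of R N) i) y 0,
    Abelian.Ext.comp_zero]

theorem IsSemiGorensteinProjective.of_projective [Module.Finite R Q] [Module.Projective R Q] :
    IsSemiGorensteinProjective R Q :=
  ⟨inferInstance, fun _ hi => subsingleton_ext_of_projective inferInstance hi⟩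

theorem IsSemiGorensteinProjective.ker [Module.FinitePresentation R M] [Module.Finite R Q]
    [Module.Projective R Q] (hM : IsSemiGorensteinProjective R M) {f : Q →ₗ[R] M}
    (hf : Function.Surjective f) : IsSemiGorensteinProjective R (LinearMap.ker f) :=
  ⟨Module.Finite.iff_fg.2 (Module.FinitePresentation.fg_ker f hf), fun i hi =>
    subsingleton_ext_ker hf inferInstance hi (hM.2 (i + 1) (by lia))⟩

end

section

variable {R S : Type u} [Ring R] [Ring S] {e : R ≃+* S} {M N M' N' : Type u} [AddCommGroup M]
  [Module R M] [AddCommGroup N] [Module R N] [AddCommGroup M'] [Module S M'] [AddCommGroup N']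
  [Module S N']

attribute [local instance] RingHomInvPair.of_ringEquiv

/-- A semilinear equivalence over a ring isomorphism, as an isomorphism with the restriction of
scalars of its target. -/
def restrictScalarsIso (g : M ≃ₛₗ[(e : R →+* S)] M') :
    ModuleCat.of R M ≅ (ModuleCat.restrictScalars e.toRingHom).obj (ModuleCat.of S M') :=
  let : Module R M' := Module.compHom M' e.toRingHom
  LinearEquiv.toModuleIso (X₂ := M')
    { g.toAddEquiv with map_smul' := fun r m => g.map_smulₛₗ r m }

theorem subsingleton_ext_of_semilinearEquiv (g : M ≃ₛₗ[(e : R →+* S)] M')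
    (g' : N ≃ₛₗ[(e : R →+* S)] N') {i : ℕ}
    [Subsingleton (Abelian.Ext (ModuleCat.of S M') (ModuleCat.of S N') i)] :
    Subsingleton (Abelian.Ext (ModuleCat.of R M) (ModuleCat.of R N) i) :=
  subsingleton_ext_of_retract (.ofIso (restrictScalarsIso g)) (.ofIso (restrictScalarsIso g'))
    ((ModuleCat.restrictScalars.{u} e.toRingHom).mapExt_bijective_of_preservesProjectiveObjects
      (ModuleCat.of S M') (ModuleCat.of S N') i).2.subsingleton

theorem IsSemiGorensteinProjective.of_semilinearEquiv (g : M ≃ₛₗ[(e : R →+* S)] M')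
    (h : IsSemiGorensteinProjective S M') : IsSemiGorensteinProjective R M :=
  have := h.1
  ⟨Module.Finite.of_surjective g.symm.toLinearMap g.symm.surjective, fun i hi =>
    have := h.2 i hi
    subsingleton_ext_of_semilinearEquiv g e.toSemilinearEquiv⟩

end

section

variable {A : Type u} [Ring A] {M N : Type u} [AddCommGroup M] [Module A M] [AddCommGroup N]
  [Module A N]

theorem isInAdd_self : IsInAdd A A :=
  ⟨1, LinearMap.pi fun _ => LinearMap.id, LinearMap.proj 0, rfl⟩

theorem IsInAdd.finite (h : IsInAdd A M) : Module.Finite A M := by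
  obtain ⟨n, s, r, hrs⟩ := h
  exact .of_surjective r fun m => ⟨s m, LinearMap.congr_fun hrs m⟩

theorem IsInAdd.projective (h : IsInAdd A M) : Module.Projective A M := by
  obtain ⟨n, s, r, hrs⟩ := h
  exact .of_split s r hrs

theorem IsInAdd.isSemiGorensteinProjective (h : IsInAdd A M) : IsSemiGorensteinProjective A M :=
  have := h.finite
  have := h.projective
  .of_projective

theorem IsInAdd.dual (h : IsInAdd A M) : IsInAdd Aᵐᵒᵖ (Module.Dual A M) := by
  obtain ⟨n, s, r, hrs⟩ := h
  refine ⟨n,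
    { toFun := fun f i => MulOpposite.op (f (r (Pi.single i 1)))
      map_add' := fun _ _ => rfl
      map_smul' := fun _ _ => rfl },
    Fintype.linearCombination Aᵐᵒᵖ fun i => LinearMap.proj i ∘ₗ s, ?_⟩
  ext f m
  have hm : r (s m) = m := LinearMap.congr_fun hrs m
  calc
    _ = ∑ i, s m i • f (r (Pi.single i 1)) := by
      simp [Fintype.linearCombination_apply, LinearMap.sum_apply]
    _ = f (r (s m)) := by
      conv_rhs => rw [pi_eq_sum_univ' (s m), map_sum, map_sum]
      simp
    _ = f m := by rw [hm]

/-- The dual `φ^* : N^* → M^*` as a map of right `A`-modules. -/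
def opDualMap (φ : M →ₗ[A] N) : Module.Dual A N →ₗ[Aᵐᵒᵖ] Module.Dual A M where
  toFun f := f ∘ₗ φ
  map_add' _ _ := rfl
  map_smul' _ _ := rfl

theorem IsLeftAddApproximation.surjective_opDualMap {φ : M →ₗ[A] N} (h : IsLeftAddApproximation φ) :
    Function.Surjective (opDualMap φ) :=
  h.2 A isInAdd_self

end

section

open Abelian

variable {R : Type u} [Ring R] {L M N : Type u} [AddCommGroup L] [Module R L] [AddCommGroup M]
  [Module R M] [AddCommGroup N] [Module R N]

theorem subsingleton_ext_prod_left {i : ℕ}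
    [Subsingleton (Ext (ModuleCat.of R L) (ModuleCat.of R N) i)]
    [Subsingleton (Ext (ModuleCat.of R M) (ModuleCat.of R N) i)] :
    Subsingleton (Ext (ModuleCat.of R (L × M)) (ModuleCat.of R N) i) :=
  subsingleton_ext_of_retract (.ofIso (ModuleCat.biprodIsoProd (.of R L) (.of R M)).symm) (.refl _)
    Ext.biprodAddEquiv.subsingleton

theorem subsingleton_ext_prod_right {i : ℕ}
    [Subsingleton (Ext (ModuleCat.of R L) (ModuleCat.of R M) i)]
    [Subsingleton (Ext (ModuleCat.of R L) (ModuleCat.of R N) i)] :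
    Subsingleton (Ext (ModuleCat.of R L) (ModuleCat.of R (M × N)) i) :=
  subsingleton_ext_of_retract (.refl _) (.ofIso (ModuleCat.biprodIsoProd (.of R M) (.of R N)).symm)
    Ext.addEquivBiprod.subsingleton

end

namespace T2

variable {A : Type u} [Ring A] {X Y X' Y' : Type u} [AddCommGroup X] [Module A X] [AddCommGroup Y]
  [Module A Y] [AddCommGroup X'] [Module A X'] [AddCommGroup Y'] [Module A Y']

/-- The upper triangular matrix with rows `(a, b)` and `(0, d)`. -/
def of (a b d : A) : T2 A := ⟨!![a, b; 0, d], show (0 : A) = 0 from rfl⟩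

@[simp] theorem of_apply_zero_zero (a b d : A) : (of a b d).1 0 0 = a := rfl
@[simp] theorem of_apply_zero_one (a b d : A) : (of a b d).1 0 1 = b := rfl
@[simp] theorem of_apply_one_one (a b d : A) : (of a b d).1 1 1 = d := rfl

@[ext] theorem ext {s t : T2 A} (h₀ : s.1 0 0 = t.1 0 0) (h₁ : s.1 0 1 = t.1 0 1)
    (h₂ : s.1 1 1 = t.1 1 1) : s = t := by
  refine Subtype.ext (Matrix.ext fun i j => ?_)
  fin_cases i <;> fin_cases j
  · exact h₀
  · exact h₁
  · exact (show s.1 1 0 = 0 from s.2).trans (show t.1 1 0 = 0 from t.2).symm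
  · exact h₂

theorem eq_of (t : T2 A) : t = of (t.1 0 0) (t.1 0 1) (t.1 1 1) := by ext <;> rfl

theorem add_def (s t : T2 A) :
    s + t = of (s.1 0 0 + t.1 0 0) (s.1 0 1 + t.1 0 1) (s.1 1 1 + t.1 1 1) := eq_of (s + t)

theorem mul_def (s t : T2 A) :
    s * t = of (s.1 0 0 * t.1 0 0) (s.1 0 0 * t.1 0 1 + s.1 0 1 * t.1 1 1)
      (s.1 1 1 * t.1 1 1) := by
  rw [eq_of s, eq_of t]
  refine Subtype.ext ?_
  simp [of]

variable (A) in
/-- The scalar matrices, as a ring homomorphism `A → T_2(A)`. -/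
def diag : A →+* T2 A where
  toFun a := of a 0 a
  map_one' := by ext <;> simp
  map_zero' := by ext <;> simp
  map_add' a b := by simp [add_def]
  map_mul' a b := by simp [mul_def]

namespace Triple

/-- Restriction of scalars along `diag A` forgets the structure map of a triple. -/
def restrictScalarsEquiv (φ : Y →ₗ[A] X) :
    (ModuleCat.restrictScalars (diag A)).obj (ModuleCat.of (T2 A) (Triple φ)) ≃ₗ[A] X × Y where
  toFun v := v
  invFun v := v
  map_add' _ _ := rfl
  map_smul' a v := by
    have h : diag A a • mk φ v.1 v.2 = mk φ (a • v.1) (a • v.2) := by simp [smul_mk, diag]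
    exact h

/-- The map of triples `(X, Y)_φ → (X', Y')_ψ` with components `f` and `g`. -/
def map {φ : Y →ₗ[A] X} {ψ : Y' →ₗ[A] X'} (f : X →ₗ[A] X') (g : Y →ₗ[A] Y')
    (h : f ∘ₗ φ = ψ ∘ₗ g) : Triple φ →ₗ[T2 A] Triple ψ where
  toFun v := mk ψ (f v.1) (g v.2)
  map_add' v w := Prod.ext (map_add f v.1 w.1) (map_add g v.2 w.2)
  map_smul' t v := by
    refine Prod.ext ?_ (map_smul g _ _)
    have : f (φ v.2) = ψ (g v.2) := LinearMap.congr_fun h v.2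
    change f (t.1 0 0 • v.1 + t.1 0 1 • φ v.2) = t.1 0 0 • f v.1 + t.1 0 1 • ψ (g v.2)
    simp only [map_add, map_smul, this]

end Triple

/-- The functor `N ↦ (N, N × N)` with structure map the first projection. It is right adjoint to
restriction of scalars along `diag A`. -/
def cofree (A : Type u) [Ring A] : ModuleCat.{u} A ⥤ ModuleCat.{u} (T2 A) where
  obj N := ModuleCat.of (T2 A) (Triple (LinearMap.fst A N N))
  map f := ModuleCat.ofHom (Triple.map f.hom (f.hom.prodMap f.hom) rfl)

section

variable {V : ModuleCat.{u} (T2 A)} {N : ModuleCat.{u} A}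

theorem map_diag_smul (g : (ModuleCat.restrictScalars (diag A)).obj V ⟶ N) (a : A) (v : V) :
    g.hom (diag A a • v : V) = a • g.hom v := g.hom.map_smul a v

/-- The adjunct `v ↦ (g (e₁₁ v), (g (e₁₂ v), g (e₂₂ v)))` of `g`. -/
noncomputable def toCofree (g : (ModuleCat.restrictScalars (diag A)).obj V ⟶ N) :
    V ⟶ (cofree A).obj N :=
  ModuleCat.ofHom (Y := Triple (LinearMap.fst A N N))
    { toFun v := Triple.mk (LinearMap.fst A N N) (g.hom (of (1 : A) 0 0 • v : V))
        (g.hom (of (0 : A) 1 0 • v : V), g.hom (of (0 : A) 0 1 • v : V))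
      map_add' v w := by
        simp only [smul_add]
        exact Prod.ext (map_add g.hom _ _) (Prod.ext (map_add g.hom _ _) (map_add g.hom _ _))
      map_smul' t v := by
        have h₀ : of 1 0 0 * t = diag A (t.1 0 0) * of 1 0 0 + diag A (t.1 0 1) * of 0 1 0 := by
          simp [diag, add_def, mul_def]
        have h₁ : of 0 1 0 * t = diag A (t.1 1 1) * of 0 1 0 := by simp [diag, mul_def]
        have h₂ : of 0 0 1 * t = diag A (t.1 1 1) * of 0 0 1 := by simp [diag, mul_def]
        simp only [← mul_smul, h₀, h₁, h₂, RingHom.id_apply, smul_mk]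
        rw [add_smul]
        simp only [mul_smul]
        refine Prod.ext ((map_add g.hom _ _).trans ?_) (Prod.ext ?_ ?_)
        · rw [map_diag_smul, map_diag_smul]; rfl
        · exact map_diag_smul _ _ _
        · exact map_diag_smul _ _ _ }

/-- The adjunct of `h`: compose with the counit `(x, (n₁, n₂)) ↦ x + n₂`. -/
noncomputable def ofCofree (h : V ⟶ (cofree A).obj N) :
    (ModuleCat.restrictScalars (diag A)).obj V ⟶ N :=
  (ModuleCat.restrictScalars (diag A)).map h ≫
    (Triple.restrictScalarsEquiv (LinearMap.fst A N N)).toModuleIso.hom ≫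
      ModuleCat.ofHom (LinearMap.id.coprod (LinearMap.snd A N N))

theorem ofCofree_smul (h : V ⟶ (cofree A).obj N) (t : T2 A) (x n₁ n₂ : N) (v : V)
    (hv : h.hom v = Triple.mk (LinearMap.fst A N N) x (n₁, n₂)) :
    (ofCofree h).hom (t • v : V) = (t.1 0 0 • x + t.1 0 1 • n₁) + t.1 1 1 • n₂ := by
  change (h.hom (t • v)).1 + (h.hom (t • v)).2.2 = _
  rw [map_smul, hv]
  rfl

theorem ofCofree_toCofree (g : (ModuleCat.restrictScalars (diag A)).obj V ⟶ N) :
    ofCofree (toCofree g) = g := by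
  refine ModuleCat.hom_ext (LinearMap.ext fun (v : V) => ?_)
  have h₁ : of (1 : A) 0 0 + of 0 0 1 = 1 := by ext <;> simp [add_def]
  have hv : of (1 : A) 0 0 • v + of (0 : A) 0 1 • v = v := by rw [← add_smul, h₁, one_smul]
  exact (map_add g.hom _ _).symm.trans (congrArg g.hom hv)

theorem toCofree_ofCofree (h : V ⟶ (cofree A).obj N) : toCofree (ofCofree h) = h := by
  refine ModuleCat.hom_ext (LinearMap.ext fun v => ?_)
  have h_smul (t : T2 A) := ofCofree_smul h t _ _ _ v rfl
  refine Prod.ext ((h_smul _).trans ?_)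
    (Prod.ext ((h_smul _).trans ?_) ((h_smul _).trans ?_)) <;> simp

/-- Restriction of scalars along `diag A` is left adjoint to `cofree A`. -/
noncomputable def restrictCofreeAdj : ModuleCat.restrictScalars (diag A) ⊣ cofree A :=
  Adjunction.mkOfHomEquiv
    { homEquiv _ _ := ⟨toCofree, ofCofree, ofCofree_toCofree, toCofree_ofCofree⟩
      homEquiv_naturality_left_symm _ _ := rfl
      homEquiv_naturality_right _ _ := rfl }

end

instance : (ModuleCat.restrictScalars.{u} (diag A)).PreservesProjectiveObjects :=
  have : (cofree A).PreservesEpimorphisms := ⟨fun f hf => by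
    rw [ModuleCat.epi_iff_surjective] at hf ⊢
    exact hf.prodMap (hf.prodMap hf)⟩
  Functor.preservesProjectiveObjects_of_adjunction_of_preservesEpimorphisms restrictCofreeAdj

namespace Triple

section

variable (A N : Type u) [Ring A] [AddCommGroup N] [Module A N]

/-- The `T_2(A)`-module `(N, 0)`. -/
abbrev Upper : Type u := Triple (0 : PUnit.{u + 1} →ₗ[A] N)

/-- The `T_2(A)`-module `(0, N)`. -/
abbrev Lower : Type u := Triple (0 : N →ₗ[A] PUnit.{u + 1})

/-- The `T_2(A)`-module `(N, N)` with structure map the identity. -/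
abbrev Double : Type u := Triple (.id : N →ₗ[A] N)

/-- The inclusion of `(N, 0)` into `(N, N)`. -/
def upperInclusion : Upper A N →ₗ[T2 A] Double A N := map .id 0 rfl

/-- The projection of `(N, N)` onto `(0, N)`. -/
def lowerProjection : Double A N →ₗ[T2 A] Lower A N := map 0 .id rfl

theorem injective_upperInclusion : Function.Injective (upperInclusion A N) :=
  fun _ _ h => Prod.ext (congrArg Prod.fst h :) rfl

theorem surjective_lowerProjection : Function.Surjective (lowerProjection A N) :=
  fun v => ⟨(0, v.2), rfl⟩

theorem exact_upperInclusion_lowerProjection :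
    Function.Exact (upperInclusion A N) (lowerProjection A N) := by
  rintro ⟨x, y⟩
  constructor
  · exact fun h => ⟨(x, PUnit.unit), Prod.ext rfl (congrArg Prod.snd h).symm⟩
  · rintro ⟨v, hv⟩
    exact Prod.ext rfl (congrArg Prod.snd hv).symm

/-- The sequence `0 → (N, 0) → (N, N) → (0, N) → 0`. -/
abbrev sequence : ShortComplex (ModuleCat.{u} (T2 A)) :=
  .mk (ModuleCat.ofHom (upperInclusion A N)) (ModuleCat.ofHom (lowerProjection A N)) rfl

theorem shortExact_sequence : (sequence A N).ShortExact :=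
  ModuleCat.shortComplex_shortExact _ (exact_upperInclusion_lowerProjection A N)
    (injective_upperInclusion A N) (surjective_lowerProjection A N)

end

section

open Abelian

variable {N : Type u} [AddCommGroup N] [Module A N] {φ : Y →ₗ[A] X}

instance [Module.Finite A X] [Module.Finite A Y] : Module.Finite (T2 A) (Triple φ) :=
  finite_of_finite_restrictScalars (diag A) (Module.Finite.equiv (restrictScalarsEquiv φ).symm)

theorem subsingleton_ext_cofree {n : ℕ}
    (h : Subsingleton (Ext (ModuleCat.of A (X × Y)) (ModuleCat.of A N) n)) :
    Subsingleton (Ext (ModuleCat.of (T2 A) (Triple φ)) ((cofree A).obj (ModuleCat.of A N)) n) :=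
  have := subsingleton_ext_of_retract (.ofIso (restrictScalarsEquiv φ).toModuleIso) (.refl _) h
  (extAdjunctionHom_bijective restrictCofreeAdj (ModuleCat.of (T2 A) (Triple φ)) (ModuleCat.of A N)
    n).1.subsingleton

theorem subsingleton_ext_double {n : ℕ}
    (h : Subsingleton (Ext (ModuleCat.of A (X × Y)) (ModuleCat.of A N) n)) :
    Subsingleton (Ext (ModuleCat.of (T2 A) (Triple φ)) (ModuleCat.of (T2 A) (Double A N)) n) :=
  subsingleton_ext_of_retract (.refl _)
    { i := ModuleCat.ofHom (map (ψ := LinearMap.fst A N N) .id (LinearMap.inl A N N) rfl)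
      r := ModuleCat.ofHom (map (φ := LinearMap.fst A N N) .id (LinearMap.fst A N N) rfl) }
    (subsingleton_ext_cofree h)

theorem subsingleton_ext_lower {n : ℕ}
    (h : Subsingleton (Ext (ModuleCat.of A (X × Y)) (ModuleCat.of A N) n)) :
    Subsingleton (Ext (ModuleCat.of (T2 A) (Triple φ)) (ModuleCat.of (T2 A) (Lower A N)) n) :=
  subsingleton_ext_of_retract (.refl _)
    { i := ModuleCat.ofHom (map (ψ := LinearMap.fst A N N) 0 (LinearMap.inr A N N) rfl)
      r := ModuleCat.ofHom (map (φ := LinearMap.fst A N N) 0 (LinearMap.snd A N N) rfl) }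
    (subsingleton_ext_cofree h)

theorem exists_map_eq (f : Triple φ →ₗ[T2 A] Lower A N) :
    ∃ k : Y →ₗ[A] N, map 0 k (by ext) = f := by
  have hf (t : T2 A) (x : X) (y : Y) :
      (f (mk φ (t.1 0 0 • x + t.1 0 1 • φ y) (t.1 1 1 • y))).2 = t.1 1 1 • (f (mk φ x y)).2 :=
    congrArg Prod.snd (f.map_smul t (mk φ x y))
  refine ⟨{ toFun y := (f (mk φ 0 y)).2, map_add' y y' := ?_, map_smul' a y := ?_ }, ?_⟩
  · have : mk φ 0 (y + y') = mk φ 0 y + mk φ 0 y' := Prod.ext (add_zero 0).symm rfl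
    rw [this, map_add]
    rfl
  · simpa using hf (of 0 0 a) 0 y
  · have h (x : X) (y : Y) : (f (mk φ 0 y)).2 = (f (mk φ x y)).2 := by
      simpa using hf (of 0 0 1) x y
    exact LinearMap.ext fun v => Prod.ext rfl (h v.1 v.2)

theorem subsingleton_ext_upper
    (h : ∀ i, 1 ≤ i → Subsingleton (Ext (ModuleCat.of A (X × Y)) (ModuleCat.of A N) i))
    (hφ : ∀ k : Y →ₗ[A] N, ∃ l : X →ₗ[A] N, l ∘ₗ φ = k) {i : ℕ} (hi : 1 ≤ i) :
    Subsingleton (Ext (ModuleCat.of (T2 A) (Triple φ)) (ModuleCat.of (T2 A) (Upper A N)) i) := by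
  obtain ⟨i, rfl⟩ := Nat.exists_eq_add_of_le' hi
  refine subsingleton_ext_X₁ (shortExact_sequence A N) (subsingleton_ext_double (h _ hi))
    fun z => ?_
  rcases i with _ | i
  · obtain ⟨f, rfl⟩ := (Ext.mk₀_bijective _ _).2 z
    obtain ⟨k, hk⟩ := exists_map_eq f.hom
    obtain ⟨l, hl⟩ := hφ k
    refine ⟨Ext.mk₀ (ModuleCat.ofHom (map l k hl)), ?_⟩
    exact (Ext.mk₀_comp_mk₀ _ _).trans (congrArg Ext.mk₀ (ModuleCat.hom_ext hk))
  · exact ⟨0, (subsingleton_ext_lower (h _ (by lia))).elim _ _⟩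

variable (A) in
/-- The decomposition of `T_2(A)` into its columns. -/
def selfEquiv : T2 A ≃ₗ[T2 A] Upper A A × Double A A where
  toFun t := (mk _ (t.1 0 0) PUnit.unit, mk _ (t.1 0 1) (t.1 1 1))
  invFun v := of v.1.1 v.2.1 v.2.2
  map_add' s t := rfl
  map_smul' s t := by
    simp [mul_def, smul_mk]
  left_inv t := (eq_of t).symm
  right_inv v := rfl

theorem isSemiGorensteinProjective (hX : IsSemiGorensteinProjective A X)
    (hY : IsSemiGorensteinProjective A Y) (hφ : ∀ k : Y →ₗ[A] A, ∃ l : X →ₗ[A] A, l ∘ₗ φ = k) :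
    IsSemiGorensteinProjective (T2 A) (Triple φ) := by
  have := hX.1
  have := hY.1
  have h (i : ℕ) (hi : 1 ≤ i) :
      Subsingleton (Ext (ModuleCat.of A (X × Y)) (ModuleCat.of A A) i) :=
    have := hX.2 i hi
    have := hY.2 i hi
    subsingleton_ext_prod_left
  refine ⟨inferInstance, fun i hi => ?_⟩
  have := subsingleton_ext_upper h hφ hi
  have := subsingleton_ext_double (φ := φ) (h i hi)
  exact subsingleton_ext_of_retract (.refl _) (.ofIso (selfEquiv A).toModuleIso)
    subsingleton_ext_prod_right

end

end Triple

variable (A) in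
/-- The isomorphism `T_2(A)^op ≅ T_2(A^op)` given by reflection in the antidiagonal. -/
def opEquiv : (T2 A)ᵐᵒᵖ ≃+* T2 Aᵐᵒᵖ where
  toFun t := of (.op (t.unop.1 1 1)) (.op (t.unop.1 0 1)) (.op (t.unop.1 0 0))
  invFun t := .op (of (t.1 1 1).unop (t.1 0 1).unop (t.1 0 0).unop)
  left_inv t := MulOpposite.unop_injective (eq_of t.unop).symm
  right_inv t := (eq_of t).symm
  map_add' s t := by ext <;> rfl
  map_mul' s t := by simp [mul_def, add_comm]

namespace Triple

variable {φ : Y →ₗ[A] X} (f : Triple φ →ₗ[T2 A] T2 A)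

theorem map_smul_mk (t : T2 A) (x : X) (y : Y) :
    f (mk φ (t.1 0 0 • x + t.1 0 1 • φ y) (t.1 1 1 • y)) = t * f (mk φ x y) :=
  f.map_smul t (mk φ x y)

theorem map_mk_zero (x : X) (y : Y) :
    f (mk φ x 0) = of ((f (mk φ x y)).1 0 0) ((f (mk φ x y)).1 0 1) 0 := by
  simpa [mul_def] using map_smul_mk f (of 1 0 0) x y

theorem map_mk_map_zero (x : X) (y : Y) :
    f (mk φ (φ y) 0) = of 0 ((f (mk φ x y)).1 1 1) 0 := by
  simpa [mul_def] using map_smul_mk f (of 0 1 0) x y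

/-- The entry `(0, j)` of a map `(X, Y)_φ → T_2(A)`, restricted to `X`. -/
def firstRow (j : Fin 2) : X →ₗ[A] A where
  toFun x := (f (mk φ x 0)).1 0 j
  map_add' x x' := by
    have h : mk φ (x + x') 0 = mk φ x 0 + mk φ x' 0 := Prod.ext rfl (add_zero 0).symm
    rw [h, map_add]
    rfl
  map_smul' a x := by
    have h : f (mk φ (a • x) 0) = of a 0 0 * f (mk φ x 0) := by
      simpa using map_smul_mk f (of a 0 0) x 0
    rw [h, mul_def]
    fin_cases j <;> simp

theorem firstRow_zero_comp : firstRow f 0 ∘ₗ φ = 0 := by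
  ext y
  change (f (mk φ (φ y) 0)).1 0 0 = 0
  rw [map_mk_map_zero f 0]
  rfl

/-- The map `(X, Y)_φ → T_2(A)` with first row `(α, β)`. -/
def homOfPair (α β : X →ₗ[A] A) (h : α ∘ₗ φ = 0) : Triple φ →ₗ[T2 A] T2 A where
  toFun v := of (α v.1) (β v.1) (β (φ v.2))
  map_add' v w := by
    change of (α (v.1 + w.1)) (β (v.1 + w.1)) (β (φ (v.2 + w.2))) = _
    simp [add_def]
  map_smul' t v := by
    have hα : α (φ v.2) = 0 := LinearMap.congr_fun h v.2
    change of (α (t.1 0 0 • v.1 + t.1 0 1 • φ v.2)) (β (t.1 0 0 • v.1 + t.1 0 1 • φ v.2))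
      (β (φ (t.1 1 1 • v.2))) = _
    simp [mul_def, hα]

theorem homOfPair_firstRow :
    homOfPair (firstRow f 0) (firstRow f 1) (firstRow_zero_comp f) = f := by
  refine LinearMap.ext fun v => T2.ext ?_ ?_ ?_
  · change (f (mk φ v.1 0)).1 0 0 = (f v).1 0 0
    rw [map_mk_zero f v.1 v.2]
    rfl
  · change (f (mk φ v.1 0)).1 0 1 = (f v).1 0 1
    rw [map_mk_zero f v.1 v.2]
    rfl
  · change (f (mk φ (φ v.2) 0)).1 0 1 = (f v).1 1 1
    rw [map_mk_map_zero f v.1 v.2]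
    rfl

variable (φ) in
/-- The triple over `A^op` given by the inclusion of `Ker φ^*` into `X^*`. -/
abbrev DualTriple : Type u :=
  Triple (A := Aᵐᵒᵖ) (Y := LinearMap.ker (opDualMap φ)) (LinearMap.ker (opDualMap φ)).subtype

attribute [local instance] RingHomInvPair.of_ringEquiv

variable (φ) in
/-- The dual of `(X, Y)_φ` is the triple `Ker φ^* → X^*`, semilinearly over `opEquiv A`. -/
def dualEquiv :
    Module.Dual (T2 A) (Triple φ) ≃ₛₗ[(opEquiv A : (T2 A)ᵐᵒᵖ →+* T2 Aᵐᵒᵖ)] DualTriple φ where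
  toFun f := mk _ (firstRow f 1) ⟨firstRow f 0, firstRow_zero_comp f⟩
  invFun v := homOfPair v.2.1 v.1 v.2.2
  left_inv f := homOfPair_firstRow f
  right_inv _ := rfl
  map_add' _ _ := rfl
  map_smul' t f := by
    refine Prod.ext (LinearMap.ext fun x => ?_) (Subtype.ext (LinearMap.ext fun x => ?_))
    · change (f (mk φ x 0) * t.unop).1 0 1 = (f (mk φ x 0)).1 0 1 * t.unop.1 1 1 +
        (f (mk φ x 0)).1 0 0 * t.unop.1 0 1
      rw [mul_def, add_comm]
      rfl
    · change (f (mk φ x 0) * t.unop).1 0 0 = (f (mk φ x 0)).1 0 0 * t.unop.1 0 0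
      rw [mul_def]
      rfl

end Triple

theorem IsMonic.of_injective {M N : Type u} [AddCommGroup M] [Module (T2 A) M] [AddCommGroup N]
    [Module (T2 A) N] {f : M →ₗ[T2 A] N} (hf : Function.Injective f) (hN : IsMonic (A := A) N) :
    IsMonic (A := A) M := by
  rintro _ ⟨v, rfl⟩ _ ⟨w, rfl⟩ h
  refine hf (hN ⟨f v, (map_smul f _ _).symm⟩ ⟨f w, (map_smul f _ _).symm⟩ ?_)
  simpa using congrArg f h

theorem isMonic_finsupp (ι : Type u) : IsMonic (A := A) (ι →₀ T2 A) := by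
  rintro _ ⟨v, rfl⟩ _ ⟨w, rfl⟩ h
  refine Finsupp.ext fun i => ?_
  have hi := congrArg (fun t : T2 A => t.1 0 1) (DFunLike.congr_fun h i)
  ext
  · simp [mul_def, e22]
  · simp [mul_def, e22]
  · simpa [mul_def, e12, e22] using hi

theorem isMonic_of_isTorsionlessModule {M : Type u} [AddCommGroup M] [Module (T2 A) M]
    (h : IsTorsionlessModule (T2 A) M) : IsMonic (A := A) M := by
  obtain ⟨Q, _, _, f, -, hQ, hf⟩ := h
  obtain ⟨s, hs⟩ := Module.projective_def.1 hQ
  exact .of_injective (f := s ∘ₗ f) (hs.injective.comp hf) (isMonic_finsupp Q)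

theorem Triple.isSemiGorensteinProjective_dual {φ : Y →ₗ[A] X}
    [Module.FinitePresentation Aᵐᵒᵖ (Module.Dual A Y)]
    (hX : IsInAdd A X) (hY : IsSemiGorensteinProjective Aᵐᵒᵖ (Module.Dual A Y))
    (hφ : Function.Surjective (opDualMap φ)) :
    IsSemiGorensteinProjective (T2 A)ᵐᵒᵖ (Module.Dual (T2 A) (Triple φ)) := by
  have := hX.dual.finite
  have := hX.dual.projective
  exact .of_semilinearEquiv (dualEquiv φ) <| Triple.isSemiGorensteinProjective .of_projective
    (hY.ker hφ) (exists_extension_of_subsingleton_ext_one hφ (hY.2 1 le_rfl))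

end T2

theorem theorem1p7_general {A : Type u} [Ring A]
    {Y P : Type u} [AddCommGroup Y] [Module A Y] [AddCommGroup P] [Module A P]
    [Module.FinitePresentation Aᵐᵒᵖ (Module.Dual A Y)] (hY : IsDoubleSemiGorensteinProjective A Y)
    (hYt : ¬ IsTorsionlessModule A Y) (φ : Y →ₗ[A] P) (hφ : IsLeftAddApproximation φ) :
    IsDoubleSemiGorensteinProjective (T2 A) (T2.Triple φ) ∧
      ¬ T2.IsMonic (A := A) (T2.Triple φ) ∧ ¬ IsTorsionlessModule (T2 A) (T2.Triple φ) := by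
  have hmonic : ¬ T2.IsMonic (A := A) (T2.Triple φ) := fun h =>
    hYt ⟨P, _, _, φ, hφ.1.finite, hφ.1.projective, (T2.isMonic_triple φ).1 h⟩
  exact ⟨⟨T2.Triple.isSemiGorensteinProjective hφ.1.isSemiGorensteinProjective hY.1
    hφ.surjective_opDualMap,
    T2.Triple.isSemiGorensteinProjective_dual hφ.1 hY.2 hφ.surjective_opDualMap⟩,
    hmonic, fun h => hmonic (T2.isMonic_of_isTorsionlessModule h)⟩

theorem theorem1p7
    -- `A` is an Artin algebra over the commutative Artinian ring `R`
    {R : Type*} [CommRing R] [IsArtinianRing R]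
    {A : Type u} [Ring A] [Algebra R A] [Module.Finite R A]
    {Y P : Type u} [AddCommGroup Y] [Module A Y] [AddCommGroup P] [Module A P]
    (hY : IsDoubleSemiGorensteinProjective A Y)
    (hYt : ¬ IsTorsionlessModule A Y)
    (φ : Y →ₗ[A] P) (hφ : IsLeftAddApproximation φ) :
    IsDoubleSemiGorensteinProjective (T2 A) (T2.Triple φ) ∧
      ¬ T2.IsMonic (A := A) (T2.Triple φ) ∧
      ¬ IsTorsionlessModule (T2 A) (T2.Triple φ) := by
  have : Module.Finite R Aᵐᵒᵖ := Module.Finite.equiv (MulOpposite.opLinearEquiv R)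
  have : IsNoetherianRing Aᵐᵒᵖ := IsNoetherianRing.of_finite R Aᵐᵒᵖ
  have := hY.2.1
  have := Module.finitePresentation_of_finite Aᵐᵒᵖ (Module.Dual A Y)
  exact theorem1p7_general hY hYt φ hφ
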